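/- Let $H\in(0,1)$ and let $B_H=\{B_H(t),t\ge 0\}$ be a fractional Brownian motion of Hurst index $H$, i.e. a centered Gaussian process with continuous sample paths and covariance $\mathbb E[B_H(t)B_H(s)]=\frac{\sigma^2}{2}\left(t^{2H}+s^{2H}-|t-s|^{2H}\right)$, where $\sigma^2=\operatorname{Var}(B_H(1))$. Let $D=\{D(s),s\ge0\}$ be a subordinator, i.e. a real-valued process with $D(0)=0$, stationary independent increments and nondecreasing right-continuous paths, with Laplace exponent $\phi$, so that $\mathbb E[e^{-\lambda D(s)}]=e^{-s\phi(\lambda)}$ for $s,\lambda\ge 0$, and assume that $\phi$ is not identically zero on $[0,\infty)$ (i.e. $D$ is not a.s. identically zero). Let $Y(t)=\inf\{s\ge 0: D(s)>t\}$, $t\ge 0$, be the inverse subordinator, and assume that the processes $B_H$ and $Y$ are independent. Put $Z(t)=B_H(Y(t))$, $U^\gamma(t)=\mathbb E[Y(t)^\gamma]\in[0,\infty]$ for $\gamma\in\mathbb R$ (with $0^\gamma=\infty$ for $\gamma<0$ and $0^0=1$), and $U=U^1$. Then, for all $t\ge 0$, the random variable $Z(t)$ is square-integrable and $U(t)$ and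 $U^{2H}(t)$ are finite; the function $U$ is nondecreasing; and for all $t,s\ge0$ $$\operatorname{Cov}(Z(t),Z(s))=\frac{\sigma^2}{2}\left\{U^{2H}(\min(t,s))+2H\int_{[0,\min(t,s)]}U^{2H-1}(\max(t,s)-y)\,dU(y)\right\},$$ where the integral is finite and $dU$ is the Lebesgue–Stieltjes measure of $U$ on $[0,\infty)$, with $U(0-)=0$ (so that it has mass $U(0)$ at $0$). -/

import Mathlib

open MeasureTheory ProbabilityTheory
open scoped NNReal ENNReal

/-- Fractional Brownian motion `(B t)_{t ≥ 0}` of Hurst index `H`: a centered Gaussian process with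
covariance `(σ² / 2) (t^{2H} + s^{2H} - |t - s|^{2H})`, where `σ² = Var (B 1)`, and with (almost
surely) continuous sample paths. -/
structure IsFractionalBrownianMotion {Ω : Type*} [MeasurableSpace Ω]
    (B : ℝ≥0 → Ω → ℝ) (H : ℝ) (P : Measure Ω) : Prop where
  measurable : ∀ t, Measurable (B t)
  isGaussianProcess : IsGaussianProcess B P
  mean_zero : ∀ t, ∫ ω, B t ω ∂P = 0
  covariance_formula : ∀ t s : ℝ≥0, ∫ ω, B t ω * B s ω ∂P =
    Var[B 1; P] / 2 *
      ((t : ℝ) ^ (2 * H) + (s : ℝ) ^ (2 * H) - |(t : ℝ) - (s : ℝ)| ^ (2 * H))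
  continuous_paths : ∀ᵐ ω ∂P, Continuous fun t => B t ω

/-- A subordinator: a real-valued process started from `0`, with stationary independent increments,
whose paths are (almost surely) nondecreasing and right-continuous. Left limits exist by
monotonicity, and there is no killing because the values are finite. -/
structure IsSubordinator {Ω : Type*} [MeasurableSpace Ω]
    (D : ℝ≥0 → Ω → ℝ) (P : Measure Ω) : Prop where
  measurable : ∀ s, Measurable (D s)
  start_zero : ∀ᵐ ω ∂P, D 0 ω = 0
  indep_increments : HasIndepIncrements D P
  stationary_increments : ∀ s h : ℝ≥0,
    IdentDistrib (fun ω => D (s + h) ω - D s ω) (D h) P P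
  monotone_paths : ∀ᵐ ω ∂P, Monotone fun s => D s ω
  rightContinuous_paths : ∀ᵐ ω ∂P, ∀ s : ℝ≥0,
    ContinuousWithinAt (fun r => D r ω) (Set.Ici s) s

/-- `φ` is the Laplace exponent of `D`: `E[exp (-l D(s))] = exp (-s φ(l))` for all `s, l ≥ 0`. -/
def HasLaplaceExponent {Ω : Type*} [MeasurableSpace Ω]
    (D : ℝ≥0 → Ω → ℝ) (φ : ℝ → ℝ) (P : Measure Ω) : Prop :=
  ∀ (s : ℝ≥0) (l : ℝ), 0 ≤ l →
    ∫ ω, Real.exp (-l * D s ω) ∂P = Real.exp (-(s : ℝ) * φ l)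

/-- The first-passage time `Y(t) = inf {s ≥ 0 : D(s) > t}`. For `t < 0` the same formula gives
`Y(t) = 0` as soon as `D(0) = 0`. -/
noncomputable def inverseProcess {Ω : Type*} (D : ℝ≥0 → Ω → ℝ) (t : ℝ) (ω : Ω) : ℝ≥0 :=
  sInf {s : ℝ≥0 | t < D s ω}

/-- The time-changed process `Z(t) = B(Y(t))`, with `Y` the inverse of `D`. -/
noncomputable def timeChanged {Ω : Type*} (B D : ℝ≥0 → Ω → ℝ) (t : ℝ) (ω : Ω) : ℝ :=
  B (inverseProcess D t ω) ω

/-- The moment `U^γ(t) = E[Y(t)^γ]`, as an element of `[0, ∞]`; here `0 ^ γ = ∞` for `γ < 0` and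
`0 ^ 0 = 1`. -/
noncomputable def inverseMoment {Ω : Type*} [MeasurableSpace Ω]
    (D : ℝ≥0 → Ω → ℝ) (P : Measure Ω) (γ : ℝ) (t : ℝ) : ℝ≥0∞ :=
  ∫⁻ ω, (inverseProcess D t ω : ℝ≥0∞) ^ γ ∂P

/-- The renewal function `U(t) = E[Y(t)]` as a real function on the whole line; it vanishes on the
negative half-line when `D` starts from `0`, so the Lebesgue-Stieltjes measure `dU` has mass `U(0)`
at the origin. -/
noncomputable def renewalFunction {Ω : Type*} [MeasurableSpace Ω]
    (D : ℝ≥0 → Ω → ℝ) (P : Measure Ω) (t : ℝ) : ℝ :=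
  (inverseMoment D P 1 t).toReal

open Filter Topology

/-! ### Approximation of a time from the right along a countable set -/

/-! Write `p = 2H`. Since `B` is independent of `Y`, Fubini turns the covariance into `(σ²/2)
E[Y(t)^p + Y(s)^p - |Y(t) - Y(s)|^p]` (`covariance_timeChange`). For `s ≤ t`, `Y(t)^p - (Y(t) -
Y(s))^p = p ∫₀^{Y(s)} (Y(t) - u)^(p-1) du`, and up to one point `u < Y(s)` means `D u ≤ s`.

For fixed `u`, on `D u ≤ s`, the residual time `Y(t) - u` is the passage time of an independent copy
of `D` over `t - D u` (`map_inverseProcess_sub_eq`), so the expected integrand becomes `U^(p-1)(t -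
D u)`. Integrating over `u` gives an integral against `∫₀^∞ P(D u ∈ ·) du`, which is `dU`
(`stieltjesFunction_measure_eq`). This computation (`setLIntegral_inverseMoment_sub`) takes place in
`[0, ∞]`, so Tonelli applies even when `p < 1`.

Moments are finite because `P(Y(t) > u) ≤ P(D u ≤ t)` decays exponentially in `u`. Null sets of bad
paths are removed beforehand. -/

/-- The successor of `⌊(n + 1) u⌋ / (n + 1)` on the grid of mesh `1 / (n + 1)`. -/
noncomputable def rightApprox (n : ℕ) (u : ℝ≥0) : ℝ≥0 :=
  ((⌊((n : ℝ≥0) + 1) * u⌋₊ : ℝ≥0) + 1) / ((n : ℝ≥0) + 1)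

lemma lt_rightApprox (n : ℕ) (u : ℝ≥0) : u < rightApprox n u := by
  rw [rightApprox, lt_div_iff₀ (by positivity), mul_comm]
  exact Nat.lt_floor_add_one _

lemma rightApprox_le (n : ℕ) (u : ℝ≥0) : rightApprox n u ≤ u + 1 / ((n : ℝ≥0) + 1) := by
  have hn : (0 : ℝ≥0) < (n : ℝ≥0) + 1 := by positivity
  have h : (⌊((n : ℝ≥0) + 1) * u⌋₊ : ℝ≥0) ≤ u * ((n : ℝ≥0) + 1) :=
    (Nat.floor_le zero_le).trans_eq (mul_comm _ _)
  rw [rightApprox, add_div]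
  gcongr
  exact (div_le_iff₀ hn).2 h

lemma tendsto_rightApprox (u : ℝ≥0) :
    Tendsto (fun n => rightApprox n u) atTop (𝓝[≥] u) := by
  refine tendsto_nhdsWithin_iff.2 ⟨?_, Eventually.of_forall fun n => (lt_rightApprox n u).le⟩
  have h : Tendsto (fun n : ℕ => u + 1 / ((n : ℝ≥0) + 1)) atTop (𝓝 (u + 0)) :=
    tendsto_const_nhds.add tendsto_one_div_add_atTop_nhds_zero_nat
  rw [add_zero] at h
  exact tendsto_of_tendsto_of_tendsto_of_le_of_le tendsto_const_nhds h
    (fun n => (lt_rightApprox n u).le) (fun n => rightApprox_le n u)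

/-- Only countably many grid times occur, so measurability at each fixed time suffices. -/
lemma measurable_comp_rightApprox {α : Type*} [MeasurableSpace α] {X : ℝ≥0 → α → ℝ}
    (hX : ∀ u, Measurable (X u)) (n : ℕ) :
    Measurable fun p : ℝ≥0 × α => X (rightApprox n p.1) p.2 := by
  have h : Measurable fun q : ℕ × α => X (((q.1 : ℝ≥0) + 1) / ((n : ℝ≥0) + 1)) q.2 :=
    measurable_from_prod_countable_right fun k => by
      dsimp only
      exact hX _
  have h' : Measurable fun p : ℝ≥0 × α => (⌊((n : ℝ≥0) + 1) * p.1⌋₊, p.2) :=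
    (Nat.measurable_floor.comp (measurable_fst.const_mul _)).prodMk measurable_snd
  have h'' := h.comp h'
  simp only [Function.comp_def] at h''
  simpa only [rightApprox] using h''

lemma measurable_uncurry_of_rightContinuous {α : Type*} [MeasurableSpace α] {X : ℝ≥0 → α → ℝ}
    (hX : ∀ u, Measurable (X u))
    (hc : ∀ a u, ContinuousWithinAt (fun r => X r a) (Set.Ici u) u) :
    Measurable fun p : ℝ≥0 × α => X p.1 p.2 :=
  measurable_of_tendsto_metrizable (measurable_comp_rightApprox hX) <|
    tendsto_pi_nhds.2 fun p => (hc p.2 p.1).tendsto.comp (tendsto_rightApprox p.1)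

/-- Evaluation of a path at a time, through right approximations. It is jointly measurable, and
agrees with evaluation on right-continuous paths. -/
noncomputable def pathEval (p : ℝ≥0 × (ℝ≥0 → ℝ)) : ℝ :=
  limsup (fun n => p.2 (rightApprox n p.1)) atTop

lemma measurable_pathEval : Measurable pathEval :=
  Measurable.limsup fun n =>
    measurable_comp_rightApprox (X := fun u (b : ℝ≥0 → ℝ) => b u) measurable_pi_apply n

lemma pathEval_eq {b : ℝ≥0 → ℝ} (hb : Continuous b) (u : ℝ≥0) : pathEval (u, b) = b u :=
  Tendsto.limsup_eq
    (((hb.tendsto u).mono_left nhdsWithin_le_nhds).comp (tendsto_rightApprox u))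

/-! ### First-passage times of monotone unbounded paths -/

lemma le_of_lt_inverseProcess {Ω : Type*} {D : ℝ≥0 → Ω → ℝ} {t : ℝ} {u : ℝ≥0} {ω : Ω}
    (h : u < inverseProcess D t ω) :
    D u ω ≤ t := by
  by_contra! hlt
  exact absurd h (csInf_le (OrderBot.bddBelow _) hlt : inverseProcess D t ω ≤ u).not_gt

/-- A process all of whose paths are nondecreasing, right-continuous, unbounded, and start
from `0`. -/
structure IsClock {Ω : Type*} [MeasurableSpace Ω] (D : ℝ≥0 → Ω → ℝ) : Prop where
  measurable : ∀ s, Measurable (D s)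
  start_zero : ∀ ω, D 0 ω = 0
  mono : ∀ ω, Monotone fun s => D s ω
  rightContinuous : ∀ ω (s : ℝ≥0), ContinuousWithinAt (fun r => D r ω) (Set.Ici s) s
  unbounded : ∀ ω (t : ℝ), ∃ s, t < D s ω

namespace IsClock

variable {Ω : Type*} [MeasurableSpace Ω] {D : ℝ≥0 → Ω → ℝ}

lemma nonneg (hD : IsClock D) (s : ℝ≥0) (ω : Ω) : 0 ≤ D s ω :=
  (hD.start_zero ω).symm.le.trans (hD.mono ω zero_le)

lemma le_inverseProcess (hD : IsClock D) {t : ℝ} {u : ℝ≥0} {ω : Ω} (h : D u ω ≤ t) :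
    u ≤ inverseProcess D t ω :=
  le_csInf (hD.unbounded ω t) fun s hs => by
    by_contra! hlt
    exact absurd (lt_of_lt_of_le hs (hD.mono ω hlt.le)) h.not_gt

/-- The path may still equal `t` at its passage time, so only times strictly after `v` are tested.
Countably many suffice, which yields joint measurability in `(t, ω)`. -/
lemma inverseProcess_le_iff (hD : IsClock D) {t : ℝ} {v : ℝ≥0} {ω : Ω} :
    inverseProcess D t ω ≤ v ↔ ∀ n : ℕ, t < D (v + 1 / ((n : ℝ≥0) + 1)) ω := by
  refine ⟨fun h n => ?_, fun h => ?_⟩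
  · by_contra! hle
    have h1 := (hD.le_inverseProcess hle).trans h
    have h2 : (0 : ℝ≥0) < 1 / ((n : ℝ≥0) + 1) := by positivity
    exact absurd h1 (lt_add_of_pos_right v h2).not_ge
  · have hlim : Tendsto (fun n : ℕ => v + 1 / ((n : ℝ≥0) + 1)) atTop (𝓝 (v + 0)) :=
      tendsto_const_nhds.add tendsto_one_div_add_atTop_nhds_zero_nat
    rw [add_zero] at hlim
    exact ge_of_tendsto' hlim fun n => csInf_le (OrderBot.bddBelow _) (h n)

lemma inverseProcess_mono (hD : IsClock D) (ω : Ω) : Monotone fun t => inverseProcess D t ω :=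
  fun _ t₂ h => csInf_le_csInf (OrderBot.bddBelow _) (hD.unbounded ω t₂)
    fun _ hs => lt_of_le_of_lt h hs

lemma measurable_uncurry (hD : IsClock D) : Measurable fun p : ℝ≥0 × Ω => D p.1 p.2 :=
  measurable_uncurry_of_rightContinuous hD.measurable hD.rightContinuous

lemma measurable_uncurry_inverseProcess (hD : IsClock D) :
    Measurable fun p : ℝ × Ω => inverseProcess D p.1 p.2 := by
  refine measurable_of_Iic fun v => ?_
  have : (fun p : ℝ × Ω => inverseProcess D p.1 p.2) ⁻¹' Set.Iic v =
      ⋂ n : ℕ, {p | p.1 < D (v + 1 / ((n : ℝ≥0) + 1)) p.2} := by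
    ext p
    simp [hD.inverseProcess_le_iff]
  rw [this]
  exact MeasurableSet.iInter fun n =>
    measurableSet_lt measurable_fst ((hD.measurable _).comp measurable_snd)

lemma measurable_inverseProcess (hD : IsClock D) (t : ℝ) : Measurable (inverseProcess D t) :=
  hD.measurable_uncurry_inverseProcess.comp measurable_prodMk_left

end IsClock

/-! ### The simple Markov property for the first-passage time -/

namespace IsClock

variable {Ω : Type*} [MeasurableSpace Ω] {D : ℝ≥0 → Ω → ℝ} {P : Measure Ω}

lemma inverseMoment_mono (hD : IsClock D) {γ : ℝ} (hγ : 0 ≤ γ) :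
    Monotone (inverseMoment D P γ) := fun _ _ h => by
  refine lintegral_mono fun ω => ENNReal.rpow_le_rpow ?_ hγ
  exact ENNReal.coe_le_coe.2 (hD.inverseProcess_mono ω h)

lemma monotone_renewalFunction (hD : IsClock D) (hfin : ∀ t, inverseMoment D P 1 t ≠ ∞) :
    Monotone (renewalFunction D P) := fun _ t₂ h =>
  ENNReal.toReal_mono (hfin t₂) (hD.inverseMoment_mono zero_le_one h)

variable [IsProbabilityMeasure P]

/-- Subtracting `D u` isolates the increment, which is independent of `D u` and distributed as `D
h`; the second factor carries the copy. -/
lemma measure_le_and_lt_eq_prod (hD : IsClock D)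
    (hind : ∀ u h : ℝ≥0, IndepFun (D u) (fun ω => D (u + h) ω - D u ω) P)
    (hst : ∀ u h : ℝ≥0, IdentDistrib (fun ω => D (u + h) ω - D u ω) (D h) P P)
    (u h : ℝ≥0) (s t : ℝ) :
    P {ω | D u ω ≤ s ∧ t < D (u + h) ω} =
      (P.prod P) {p | D u p.1 ≤ s ∧ t - D u p.1 < D h p.2} := by
  have hS : MeasurableSet {q : ℝ × ℝ | q.1 ≤ s ∧ t - q.1 < q.2} :=
    (measurableSet_le measurable_fst measurable_const).inter
      (measurableSet_lt (measurable_const.sub measurable_fst) measurable_snd)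
  have hinc : Measurable fun ω => D (u + h) ω - D u ω := (hD.measurable _).sub (hD.measurable _)
  have h1 := (indepFun_iff_map_prod_eq_prod_map_map (hD.measurable u).aemeasurable
    hinc.aemeasurable).1 (hind u h)
  rw [(hst u h).map_eq, Measure.map_prod_map _ _ (hD.measurable u) (hD.measurable h)] at h1
  have h2 := congrArg (fun μ => μ {q : ℝ × ℝ | q.1 ≤ s ∧ t - q.1 < q.2}) h1
  beta_reduce at h2
  rw [Measure.map_apply ((hD.measurable u).prodMk hinc) hS,
    Measure.map_apply ((hD.measurable u).prodMap (hD.measurable h)) hS] at h2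
  convert h2 using 2
  · ext ω
    simp
  · ext p
    simp

/-- Markov property at the fixed time `u`. No relation between `s` and `t` is needed: if `t < D u`,
truncated subtraction gives `0` on the left, and passage over a negative level takes time `0` on the
right. -/
lemma map_inverseProcess_sub_eq (hD : IsClock D)
    (hind : ∀ u h : ℝ≥0, IndepFun (D u) (fun ω => D (u + h) ω - D u ω) P)
    (hst : ∀ u h : ℝ≥0, IdentDistrib (fun ω => D (u + h) ω - D u ω) (D h) P P)
    (u : ℝ≥0) (s t : ℝ) :
    (P.restrict {ω | D u ω ≤ s}).map (fun ω => inverseProcess D t ω - u) =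
      ((P.restrict {ω | D u ω ≤ s}).prod P).map
        (fun p => inverseProcess D (t - D u p.1) p.2) := by
  have hA : MeasurableSet {ω | D u ω ≤ s} := measurableSet_le (hD.measurable u) measurable_const
  have hm1 : Measurable fun ω => inverseProcess D t ω - u :=
    (hD.measurable_inverseProcess t).sub_const u
  have hm2 : Measurable fun p : Ω × Ω => inverseProcess D (t - D u p.1) p.2 :=
    hD.measurable_uncurry_inverseProcess.comp
      ((measurable_const.sub ((hD.measurable u).comp measurable_fst)).prodMk measurable_snd)
  have hprod : (P.restrict {ω | D u ω ≤ s}).prod P =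
      (P.prod P).restrict ({ω | D u ω ≤ s} ×ˢ Set.univ) := by
    rw [← Measure.prod_restrict, Measure.restrict_univ]
  refine Measure.ext_of_Iic _ _ fun r => ?_
  rw [Measure.map_apply hm1 measurableSet_Iic, Measure.map_apply hm2 measurableSet_Iic, hprod,
    Measure.restrict_apply (hm1 measurableSet_Iic), Measure.restrict_apply (hm2 measurableSet_Iic)]
  -- Each event `{· ≤ r}` is a decreasing limit of events involving `D` at the single later time `r
  -- + e n`, where the product formula applies.
  let e : ℕ → ℝ≥0 := fun n => 1 / ((n : ℝ≥0) + 1)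
  have he : Antitone e := fun m n hmn => by
    have : (m : ℝ≥0) ≤ n := by exact_mod_cast hmn
    simp only [e]
    gcongr
  have e1 : (fun ω => inverseProcess D t ω - u) ⁻¹' Set.Iic r ∩ {ω | D u ω ≤ s} =
      ⋂ n, {ω | D u ω ≤ s ∧ t < D (u + (r + e n)) ω} := by
    ext ω
    simp only [Set.mem_inter_iff, Set.mem_preimage, Set.mem_Iic, tsub_le_iff_right,
      hD.inverseProcess_le_iff, Set.mem_ofPred_eq, Set.mem_iInter, e, add_comm r u, add_assoc]
    exact ⟨fun h n => ⟨h.2, h.1 n⟩, fun h => ⟨fun n => (h n).2, (h 0).1⟩⟩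
  have e2 : (fun p : Ω × Ω => inverseProcess D (t - D u p.1) p.2) ⁻¹' Set.Iic r ∩
      ({ω | D u ω ≤ s} ×ˢ Set.univ) =
      ⋂ n, {p | D u p.1 ≤ s ∧ t - D u p.1 < D (r + e n) p.2} := by
    ext p
    simp only [Set.mem_inter_iff, Set.mem_preimage, Set.mem_Iic, Set.mem_prod, Set.mem_univ,
      hD.inverseProcess_le_iff, Set.mem_ofPred_eq, Set.mem_iInter, e, and_true]
    exact ⟨fun h n => ⟨h.2, h.1 n⟩, fun h => ⟨fun n => (h n).2, (h 0).1⟩⟩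
  rw [e1, e2]
  have l1 : Tendsto (fun n => P {ω | D u ω ≤ s ∧ t < D (u + (r + e n)) ω}) atTop
      (𝓝 (P (⋂ n, {ω | D u ω ≤ s ∧ t < D (u + (r + e n)) ω}))) := by
    refine tendsto_measure_iInter_atTop (fun n => ?_) ?_ ⟨0, measure_ne_top _ _⟩
    · exact (hA.inter (measurableSet_lt measurable_const (hD.measurable _))).nullMeasurableSet
    · intro m n hmn ω hω
      have := he hmn
      exact ⟨hω.1, hω.2.trans_le (hD.mono ω (by gcongr))⟩
  have l2 : Tendsto (fun n => (P.prod P) {p | D u p.1 ≤ s ∧ t - D u p.1 < D (r + e n) p.2}) atTop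
      (𝓝 ((P.prod P) (⋂ n, {p | D u p.1 ≤ s ∧ t - D u p.1 < D (r + e n) p.2}))) := by
    refine tendsto_measure_iInter_atTop (fun n => ?_) ?_ ⟨0, measure_ne_top _ _⟩
    · exact ((measurable_fst hA).inter (measurableSet_lt
        (measurable_const.sub ((hD.measurable u).comp measurable_fst))
        ((hD.measurable _).comp measurable_snd))).nullMeasurableSet
    · intro m n hmn p hp
      have := he hmn
      exact ⟨hp.1, hp.2.trans_le (hD.mono p.2 (by gcongr))⟩
  simp only [hD.measure_le_and_lt_eq_prod hind hst] at l1
  exact tendsto_nhds_unique l1 l2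

lemma setLIntegral_inverseProcess_sub_rpow (hD : IsClock D)
    (hind : ∀ u h : ℝ≥0, IndepFun (D u) (fun ω => D (u + h) ω - D u ω) P)
    (hst : ∀ u h : ℝ≥0, IdentDistrib (fun ω => D (u + h) ω - D u ω) (D h) P P)
    (u : ℝ≥0) (s t γ : ℝ) :
    ∫⁻ ω in {ω | D u ω ≤ s}, ((inverseProcess D t ω - u : ℝ≥0) : ℝ≥0∞) ^ γ ∂P =
      ∫⁻ ω in {ω | D u ω ≤ s}, inverseMoment D P γ (t - D u ω) ∂P := by
  have hm1 : Measurable fun ω => inverseProcess D t ω - u :=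
    (hD.measurable_inverseProcess t).sub_const u
  have hm2 : Measurable fun p : Ω × Ω => inverseProcess D (t - D u p.1) p.2 :=
    hD.measurable_uncurry_inverseProcess.comp
      ((measurable_const.sub ((hD.measurable u).comp measurable_fst)).prodMk measurable_snd)
  have hg : Measurable fun x : ℝ≥0 => (x : ℝ≥0∞) ^ γ := measurable_coe_nnreal_ennreal.pow_const γ
  rw [← lintegral_map (f := fun x : ℝ≥0 => (x : ℝ≥0∞) ^ γ) hg hm1,
    hD.map_inverseProcess_sub_eq hind hst, lintegral_map hg hm2,
    lintegral_prod (fun p : Ω × Ω => (inverseProcess D (t - D u p.1) p.2 : ℝ≥0∞) ^ γ)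
      (hg.comp hm2).aemeasurable]
  rfl

/-! ### The renewal measure -/

/-- The occupation measure `∫₀^∞ P (D u ∈ ·) du`. -/
noncomputable def _root_.occupationMeasure (D : ℝ≥0 → Ω → ℝ) (P : Measure Ω) : Measure ℝ :=
  ((volume.restrict (Set.Ioi (0 : ℝ))).prod P).map fun q => D q.1.toNNReal q.2

lemma measurable_uncurry_toNNReal (hD : IsClock D) :
    Measurable fun q : ℝ × Ω => D q.1.toNNReal q.2 :=
  hD.measurable_uncurry.comp ((measurable_real_toNNReal.comp measurable_fst).prodMk measurable_snd)

lemma setOf_le_ae_eq_Ioc (hD : IsClock D) (t : ℝ) (ω : Ω) :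
    ({u : ℝ | D u.toNNReal ω ≤ t} ∩ Set.Ioi 0 : Set ℝ) =ᵐ[volume]
      Set.Ioc (0 : ℝ) (inverseProcess D t ω) := by
  refine Filter.EventuallyLE.antisymm (LE.le.eventuallyLE ?_)
    (Ioo_ae_eq_Ioc.symm.le.trans (LE.le.eventuallyLE ?_))
  · intro u hu
    exact ⟨hu.2, (Real.toNNReal_le_iff_le_coe).1 (hD.le_inverseProcess hu.1)⟩
  · intro u hu
    refine ⟨le_of_lt_inverseProcess ?_, hu.1⟩
    exact (Real.toNNReal_lt_iff_lt_coe hu.1.le).2 hu.2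

/-- By Tonelli: a path spends Lebesgue time exactly `Y(t)` at or below level `t`. -/
lemma occupationMeasure_Iic (hD : IsClock D) (t : ℝ) :
    occupationMeasure D P (Set.Iic t) = inverseMoment D P 1 t := by
  rw [occupationMeasure, Measure.map_apply hD.measurable_uncurry_toNNReal measurableSet_Iic,
    Measure.prod_apply_symm (hD.measurable_uncurry_toNNReal measurableSet_Iic), inverseMoment]
  refine lintegral_congr fun ω => ?_
  rw [Measure.restrict_apply
    (measurable_prodMk_right (hD.measurable_uncurry_toNNReal measurableSet_Iic))]
  have := measure_congr (hD.setOf_le_ae_eq_Ioc t ω)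
  simp only [Real.volume_Ioc, sub_zero, ENNReal.ofReal_coe_nnreal] at this
  rw [ENNReal.rpow_one, ← this]
  rfl

/-- Continuity from above of the occupation measure. It is needed because the Stieltjes function is
built from right limits. -/
lemma rightLim_renewalFunction (hD : IsClock D) (hfin : ∀ t, inverseMoment D P 1 t ≠ ∞)
    (t : ℝ) : Function.rightLim (renewalFunction D P) t = renewalFunction D P t := by
  have hU := hD.monotone_renewalFunction hfin
  have h1 : Tendsto (fun n : ℕ => t + 1 / ((n : ℝ) + 1)) atTop (𝓝[>] t) := by
    refine tendsto_nhdsWithin_iff.2 ⟨?_, Eventually.of_forall fun n => ?_⟩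
    · simpa using tendsto_const_nhds.add (tendsto_one_div_add_atTop_nhds_zero_nat (𝕜 := ℝ))
    · have : (0 : ℝ) < 1 / ((n : ℝ) + 1) := by positivity
      simpa using this
  have h2 := (hU.tendsto_rightLim t).comp h1
  refine tendsto_nhds_unique h2 ?_
  have h3 : Tendsto (fun n : ℕ => occupationMeasure D P (Set.Iic (t + 1 / ((n : ℝ) + 1)))) atTop
      (𝓝 (occupationMeasure D P (⋂ n : ℕ, Set.Iic (t + 1 / ((n : ℝ) + 1))))) := by
    refine tendsto_measure_iInter_atTop (fun n => measurableSet_Iic.nullMeasurableSet) ?_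
      ⟨0, by rw [hD.occupationMeasure_Iic]; exact hfin _⟩
    intro m n hmn
    have : (m : ℝ) ≤ n := by exact_mod_cast hmn
    exact Set.Iic_subset_Iic.2 (by gcongr)
  have h4 : ⋂ n : ℕ, Set.Iic (t + 1 / ((n : ℝ) + 1)) = Set.Iic t := by
    ext x
    simp only [Set.mem_iInter, Set.mem_Iic]
    refine ⟨fun h => ge_of_tendsto' (h1.mono_right nhdsWithin_le_nhds) h, fun h n => ?_⟩
    have : (0 : ℝ) < 1 / ((n : ℝ) + 1) := by positivity
    linarith
  rw [h4] at h3
  simp only [hD.occupationMeasure_Iic] at h3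
  exact (ENNReal.tendsto_toReal (hfin t)).comp h3

lemma stieltjesFunction_measure_eq (hD : IsClock D) (hfin : ∀ t, inverseMoment D P 1 t ≠ ∞)
    (hU : Monotone (renewalFunction D P)) :
    hU.stieltjesFunction.measure = occupationMeasure D P := by
  refine Measure.ext_of_Ioc _ _ fun a b hab => ?_
  have hne : occupationMeasure D P (Set.Iic a) ≠ ∞ := by
    rw [hD.occupationMeasure_Iic]; exact hfin a
  rw [StieltjesFunction.measure_Ioc, hU.stieltjesFunction_eq, hU.stieltjesFunction_eq,
    hD.rightLim_renewalFunction hfin, hD.rightLim_renewalFunction hfin, ← Set.Iic_sdiff_Iic,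
    measure_sdiff (Set.Iic_subset_Iic.2 hab.le) measurableSet_Iic.nullMeasurableSet hne,
    hD.occupationMeasure_Iic, hD.occupationMeasure_Iic, renewalFunction, renewalFunction,
    ENNReal.ofReal_sub _ ENNReal.toReal_nonneg, ENNReal.ofReal_toReal (hfin b),
    ENNReal.ofReal_toReal (hfin a)]

end IsClock

/-! ### Integrals of translated powers -/

lemma integrableOn_sub_rpow {p a b : ℝ} (hp : 0 < p) (ha : 0 ≤ a) :
    IntegrableOn (fun u => (b - u) ^ (p - 1)) (Set.Ioc 0 a) := by
  have h : IntervalIntegrable (fun u : ℝ => u ^ (p - 1)) volume (b - 0) (b - a) :=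
    intervalIntegral.intervalIntegrable_rpow' (by linarith)
  exact (intervalIntegrable_iff_integrableOn_Ioc_of_le ha).1
    (by simpa using h.comp_sub_left b)

lemma setIntegral_sub_rpow {p a b : ℝ} (hp : 0 < p) (ha : 0 ≤ a) :
    ∫ u in Set.Ioc 0 a, (b - u) ^ (p - 1) = (b ^ p - (b - a) ^ p) / p := by
  rw [← intervalIntegral.integral_of_le ha,
    intervalIntegral.integral_comp_sub_left (fun x => x ^ (p - 1)) b,
    integral_rpow (Or.inl (by linarith))]
  simp

lemma setLIntegral_sub_rpow {p : ℝ} (hp : 0 < p) {a b : ℝ≥0} (hab : a ≤ b) :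
    ∫⁻ u in Set.Ioc (0 : ℝ) a, ((b - u.toNNReal : ℝ≥0) : ℝ≥0∞) ^ (p - 1) =
      ENNReal.ofReal (((b : ℝ) ^ p - ((b - a : ℝ≥0) : ℝ) ^ p) / p) := by
  have hab' : (a : ℝ) ≤ b := by exact_mod_cast hab
  rw [NNReal.coe_sub hab, ← setIntegral_sub_rpow hp a.coe_nonneg,
    ofReal_integral_eq_lintegral_ofReal (integrableOn_sub_rpow hp a.coe_nonneg),
    -- The endpoint is dropped because for `a = b` and `p < 1` the power of `0` is `∞` in `ℝ≥0∞` but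
    -- `0` in `ℝ`.
    ← setLIntegral_congr (Ioo_ae_eq_Ioc (a := (0 : ℝ)) (b := (a : ℝ))),
    ← setLIntegral_congr (Ioo_ae_eq_Ioc (a := (0 : ℝ)) (b := (a : ℝ)))]
  · refine setLIntegral_congr_fun measurableSet_Ioo fun u hu => ?_
    have hub : (0 : ℝ) < b - u := by linarith [hu.2]
    have : ((b - u.toNNReal : ℝ≥0) : ℝ≥0∞) = ENNReal.ofReal (b - u) := by
      rw [ENNReal.ofReal_sub _ hu.1.le, ENNReal.coe_sub, ENNReal.ofReal_coe_nnreal]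
      rfl
    simp only [this, ENNReal.ofReal_rpow_of_pos hub]
  · filter_upwards [ae_restrict_mem measurableSet_Ioc] with u hu
    exact Real.rpow_nonneg (by linarith [hu.2] : (0 : ℝ) ≤ b - u) _

lemma inverseMoment_eq_lintegral_ofReal {Ω : Type*} [MeasurableSpace Ω] (D : ℝ≥0 → Ω → ℝ)
    (P : Measure Ω) {p : ℝ} (hp : 0 ≤ p) (t : ℝ) :
    inverseMoment D P p t = ∫⁻ ω, ENNReal.ofReal ((inverseProcess D t ω : ℝ) ^ p) ∂P :=
  lintegral_congr fun ω => by
    rw [← ENNReal.ofReal_rpow_of_nonneg (NNReal.coe_nonneg _) hp, ENNReal.ofReal_coe_nnreal]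

/-! ### Finite moments and the renewal integral -/

namespace IsClock

variable {Ω : Type*} [MeasurableSpace Ω] {D : ℝ≥0 → Ω → ℝ} {P : Measure Ω}

/-- Layer-cake formula: the exponential tail bounds the moment by a Gamma integral. -/
lemma inverseMoment_ne_top (hD : IsClock D) {p c C t : ℝ} (hp : 0 < p) (hc : 0 < c)
    (htail : ∀ u : ℝ≥0, P {ω | D u ω ≤ t} ≤ ENNReal.ofReal (C * Real.exp (-c * u))) :
    inverseMoment D P p t ≠ ∞ := by
  have h := lintegral_rpow_eq_lintegral_meas_lt_mul P
    (f := fun ω => (inverseProcess D t ω : ℝ)) (Eventually.of_forall fun ω => NNReal.coe_nonneg _)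
    (hD.measurable_inverseProcess t).coe_nnreal_real.aemeasurable hp
  rw [inverseMoment_eq_lintegral_ofReal D P hp.le, h]
  refine ENNReal.mul_ne_top ENNReal.ofReal_ne_top (ne_top_of_le_ne_top ?_
    (setLIntegral_mono' (g := fun u => ENNReal.ofReal (C * (u ^ (p - 1) * Real.exp (-c * u))))
      measurableSet_Ioi fun u hu => ?_))
  · have h_int : IntegrableOn (fun u : ℝ => u ^ (p - 1) * Real.exp (-c * u ^ (1 : ℝ)))
        (Set.Ioi 0) :=
      integrableOn_rpow_mul_exp_neg_mul_rpow (by linarith) zero_lt_one hc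
    simp only [Real.rpow_one] at h_int
    exact (h_int.const_mul C).lintegral_lt_top.ne
  · have hu' : (0 : ℝ) < u := hu
    have h1 : P {ω | u < (inverseProcess D t ω : ℝ)} ≤
        ENNReal.ofReal (C * Real.exp (-c * u)) := by
      have := htail u.toNNReal
      rw [Real.coe_toNNReal u hu'.le] at this
      refine le_trans (measure_mono fun ω hω => ?_) this
      exact le_of_lt_inverseProcess ((Real.toNNReal_lt_iff_lt_coe hu'.le).2 hω)
    refine (mul_le_mul_left h1 _).trans_eq ?_
    rw [← ENNReal.ofReal_mul' (Real.rpow_nonneg hu'.le _)]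
    congr 1
    ring

variable [IsProbabilityMeasure P]

lemma measurable_inverseMoment (hD : IsClock D) (γ : ℝ) : Measurable (inverseMoment D P γ) :=
  Measurable.lintegral_prod_right'
    (f := fun p : ℝ × Ω => (inverseProcess D p.1 p.2 : ℝ≥0∞) ^ γ)
    (hD.measurable_uncurry_inverseProcess.coe_nnreal_ennreal.pow_const γ)

lemma setLIntegral_inverseMoment_sub (hD : IsClock D)
    (hind : ∀ u h : ℝ≥0, IndepFun (D u) (fun ω => D (u + h) ω - D u ω) P)
    (hst : ∀ u h : ℝ≥0, IdentDistrib (fun ω => D (u + h) ω - D u ω) (D h) P P)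
    {p : ℝ} (hp : 0 < p) {s t : ℝ} (hst' : s ≤ t) :
    ∫⁻ y in Set.Icc 0 s, inverseMoment D P (p - 1) (t - y) ∂occupationMeasure D P =
      ∫⁻ ω, ENNReal.ofReal (((inverseProcess D t ω : ℝ) ^ p -
        ((inverseProcess D t ω - inverseProcess D s ω : ℝ≥0) : ℝ) ^ p) / p) ∂P := by
  have hm := hD.measurable_uncurry_toNNReal
  have hA (u : ℝ≥0) : MeasurableSet {ω | D u ω ≤ s} :=
    measurableSet_le (hD.measurable u) measurable_const
  have hA' : MeasurableSet {q : ℝ × Ω | D q.1.toNNReal q.2 ≤ s} :=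
    measurableSet_le hm measurable_const
  have hF : Measurable ((Set.Icc 0 s).indicator
      fun y => inverseMoment D P (p - 1) (t - y)) :=
    ((hD.measurable_inverseMoment _).comp (measurable_const.sub measurable_id)).indicator
      measurableSet_Icc
  let G : ℝ × Ω → ℝ≥0∞ := {q : ℝ × Ω | D q.1.toNNReal q.2 ≤ s}.indicator fun q =>
    ((inverseProcess D t q.2 - q.1.toNNReal : ℝ≥0) : ℝ≥0∞) ^ (p - 1)
  have hG : Measurable G := by
    refine Measurable.indicator ?_ hA'
    exact ((((hD.measurable_inverseProcess t).comp measurable_snd).sub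
      (measurable_real_toNNReal.comp measurable_fst)).coe_nnreal_ennreal).pow_const _
  rw [← lintegral_indicator measurableSet_Icc, occupationMeasure, lintegral_map hF hm,
    lintegral_prod (fun q : ℝ × Ω => (Set.Icc 0 s).indicator
      (fun y => inverseMoment D P (p - 1) (t - y)) (D q.1.toNNReal q.2))
      (hF.comp hm).aemeasurable]
  have h1 (u : ℝ) : ∫⁻ ω, (Set.Icc 0 s).indicator
      (fun y => inverseMoment D P (p - 1) (t - y)) (D u.toNNReal ω) ∂P = ∫⁻ ω, G (u, ω) ∂P := by
    -- As `D ≥ 0`, membership in `[0, s]` reduces to `D u ≤ s`.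
    have e1 : (fun ω => (Set.Icc 0 s).indicator
        (fun y => inverseMoment D P (p - 1) (t - y)) (D u.toNNReal ω)) =
        {ω | D u.toNNReal ω ≤ s}.indicator
          fun ω => inverseMoment D P (p - 1) (t - D u.toNNReal ω) := by
      ext ω
      simp [Set.indicator_apply, hD.nonneg]
    have e2 : (fun ω => G (u, ω)) = {ω | D u.toNNReal ω ≤ s}.indicator fun ω =>
        ((inverseProcess D t ω - u.toNNReal : ℝ≥0) : ℝ≥0∞) ^ (p - 1) := by
      ext ω
      simp [G, Set.indicator_apply]
    rw [e1, e2, lintegral_indicator (hA _), lintegral_indicator (hA _),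
      hD.setLIntegral_inverseProcess_sub_rpow hind hst]
  simp only [h1]
  -- The Markov property was used at fixed `u`; the power is now integrated over `u` at fixed `ω`.
  rw [lintegral_lintegral_swap (f := fun u ω => G (u, ω)) hG.aemeasurable]
  refine lintegral_congr fun ω => ?_
  have hAω : MeasurableSet {u : ℝ | D u.toNNReal ω ≤ s} := measurable_prodMk_right hA'
  have e3 : (fun u : ℝ => G (u, ω)) = {u : ℝ | D u.toNNReal ω ≤ s}.indicator fun u =>
      ((inverseProcess D t ω - u.toNNReal : ℝ≥0) : ℝ≥0∞) ^ (p - 1) := by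
    ext u
    simp [G, Set.indicator_apply]
  rw [e3, lintegral_indicator hAω, Measure.restrict_restrict hAω,
    setLIntegral_congr (hD.setOf_le_ae_eq_Ioc s ω),
    setLIntegral_sub_rpow hp (hD.inverseProcess_mono ω hst')]

end IsClock

/-! ### Evaluation of a continuous process at independent random times -/

section TimeChange

variable {Ω : Type*} [MeasurableSpace Ω] {P : Measure Ω} [IsProbabilityMeasure P]
  {B : ℝ≥0 → Ω → ℝ} {S T : Ω → ℝ≥0}

/-- Independence gives the joint law of times and path as a product. `pathEval` transfers this to
the evaluated values, being measurable on the full path space, where plain evaluation at a varying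
time is not. -/
lemma identDistrib_timeChange (hm : ∀ t, Measurable (B t)) (hc : ∀ ω, Continuous fun t => B t ω)
    (hS : Measurable S) (hT : Measurable T)
    (hind : IndepFun (fun ω t => B t ω) (fun ω => (T ω, S ω)) P) :
    IdentDistrib (fun ω => (B (T ω) ω, B (S ω) ω))
      (fun p : Ω × Ω => (B (T p.1) p.2, B (S p.1) p.2)) P (P.prod P) := by
  have hB : Measurable fun ω t => B t ω := measurable_pi_iff.2 hm
  have hTS : Measurable fun ω => (T ω, S ω) := hT.prodMk hS
  have h1 := (indepFun_iff_map_prod_eq_prod_map_map hTS.aemeasurable hB.aemeasurable).1 hind.symm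
  rw [Measure.map_prod_map _ _ hTS hB] at h1
  have h2 : IdentDistrib (fun ω => ((T ω, S ω), fun t => B t ω))
      (Prod.map (fun ω => (T ω, S ω)) fun ω t => B t ω) P (P.prod P) :=
    ⟨(hTS.prodMk hB).aemeasurable, (hTS.prodMap hB).aemeasurable, h1⟩
  have hE : Measurable fun q : (ℝ≥0 × ℝ≥0) × (ℝ≥0 → ℝ) =>
      (pathEval (q.1.1, q.2), pathEval (q.1.2, q.2)) :=
    (measurable_pathEval.comp ((measurable_fst.comp measurable_fst).prodMk measurable_snd)).prodMk
      (measurable_pathEval.comp ((measurable_snd.comp measurable_fst).prodMk measurable_snd))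
  have h3 := h2.comp hE
  simpa only [Function.comp_def, Prod.map, pathEval_eq (hc _)] using h3

lemma measurable_timeChange_prod (hm : ∀ t, Measurable (B t))
    (hc : ∀ ω, Continuous fun t => B t ω) (hT : Measurable T) :
    Measurable fun p : Ω × Ω => B (T p.1) p.2 :=
  (measurable_uncurry_of_rightContinuous hm fun ω _ => (hc ω).continuousWithinAt).comp
    ((hT.comp measurable_fst).prodMk measurable_snd)

lemma memLp_timeChange_prod {V p : ℝ} (hp : 0 < p) (hm : ∀ t, Measurable (B t))
    (hc : ∀ ω, Continuous fun t => B t ω) (hL2 : ∀ t, MemLp (B t) 2 P)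
    (hcov : ∀ t s : ℝ≥0, ∫ ω, B t ω * B s ω ∂P =
      V / 2 * ((t : ℝ) ^ p + (s : ℝ) ^ p - |(t : ℝ) - (s : ℝ)| ^ p))
    (hT : Measurable T) (hTp : Integrable (fun ω => (T ω : ℝ) ^ p) P) :
    MemLp (fun q : Ω × Ω => B (T q.1) q.2) 2 (P.prod P) := by
  have hmeas := measurable_timeChange_prod hm hc hT
  rw [memLp_two_iff_integrable_sq hmeas.aestronglyMeasurable,
    integrable_prod_iff (hmeas.pow_const 2).aestronglyMeasurable]
  refine ⟨Eventually.of_forall fun ω => (hL2 (T ω)).integrable_sq, ?_⟩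
  have h (ω : Ω) : ∫ ω', ‖B (T ω) ω' ^ 2‖ ∂P = V * (T ω : ℝ) ^ p := by
    have h1 := hcov (T ω) (T ω)
    rw [sub_self, abs_zero, Real.zero_rpow hp.ne'] at h1
    have h2 : (fun ω' => ‖B (T ω) ω' ^ 2‖) = fun ω' => B (T ω) ω' * B (T ω) ω' := by
      ext ω'
      rw [Real.norm_of_nonneg (sq_nonneg _), pow_two]
    rw [h2, h1]
    ring
  simp only [h]
  exact hTp.const_mul V

theorem memLp_timeChange {V p : ℝ} (hp : 0 < p) (hm : ∀ t, Measurable (B t))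
    (hc : ∀ ω, Continuous fun t => B t ω) (hL2 : ∀ t, MemLp (B t) 2 P)
    (hcov : ∀ t s : ℝ≥0, ∫ ω, B t ω * B s ω ∂P =
      V / 2 * ((t : ℝ) ^ p + (s : ℝ) ^ p - |(t : ℝ) - (s : ℝ)| ^ p))
    (hT : Measurable T) (hTp : Integrable (fun ω => (T ω : ℝ) ^ p) P)
    (hind : IndepFun (fun ω t => B t ω) (fun ω => (T ω, T ω)) P) :
    MemLp (fun ω => B (T ω) ω) 2 P :=
  ((identDistrib_timeChange hm hc hT hT hind).comp measurable_fst).memLp_iff.2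
    (memLp_timeChange_prod hp hm hc hL2 hcov hT hTp)

theorem covariance_timeChange {V p : ℝ} (hp : 0 < p) (hm : ∀ t, Measurable (B t))
    (hc : ∀ ω, Continuous fun t => B t ω) (hL2 : ∀ t, MemLp (B t) 2 P)
    (h0 : ∀ t, ∫ ω, B t ω ∂P = 0)
    (hcov : ∀ t s : ℝ≥0, ∫ ω, B t ω * B s ω ∂P =
      V / 2 * ((t : ℝ) ^ p + (s : ℝ) ^ p - |(t : ℝ) - (s : ℝ)| ^ p))
    (hT : Measurable T) (hTp : Integrable (fun ω => (T ω : ℝ) ^ p) P)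
    (hS : Measurable S) (hSp : Integrable (fun ω => (S ω : ℝ) ^ p) P)
    (hind : IndepFun (fun ω t => B t ω) (fun ω => (T ω, S ω)) P) :
    cov[fun ω => B (T ω) ω, fun ω => B (S ω) ω; P] =
      ∫ ω, V / 2 * ((T ω : ℝ) ^ p + (S ω : ℝ) ^ p - |(T ω : ℝ) - (S ω : ℝ)| ^ p) ∂P := by
  have hid := identDistrib_timeChange hm hc hS hT hind
  have hMT := memLp_timeChange_prod hp hm hc hL2 hcov hT hTp
  have hMS := memLp_timeChange_prod hp hm hc hL2 hcov hS hSp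
  have hT0 : ∫ ω, B (T ω) ω ∂P = 0 := by
    have := (hid.comp measurable_fst).integral_eq
    simp only [Function.comp_def] at this
    rw [this, integral_prod _ (hMT.integrable one_le_two)]
    simp [h0]
  have hmul := (hid.comp (measurable_fst.mul measurable_snd)).integral_eq
  simp only [Function.comp_def, Pi.mul_apply] at hmul
  have hT2 : MemLp (fun ω => B (T ω) ω) 2 P := (hid.comp measurable_fst).memLp_iff.2 hMT
  have hS2 : MemLp (fun ω => B (S ω) ω) 2 P := (hid.comp measurable_snd).memLp_iff.2 hMS
  rw [covariance_eq_sub hT2 hS2]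
  simp only [Pi.mul_apply]
  rw [hT0, zero_mul, sub_zero, hmul, integral_prod (fun q : Ω × Ω => B (T q.1) q.2 * B (S q.1) q.2)
    (hMT.integrable_mul hMS)]
  simp only [hcov]

end TimeChange

/-! ### The covariance formula for everywhere regular paths -/

namespace IsClock

variable {Ω : Type*} [MeasurableSpace Ω] {D : ℝ≥0 → Ω → ℝ} {P : Measure Ω}

lemma integrable_inverseProcess_rpow (hD : IsClock D) {p : ℝ} (hp : 0 ≤ p) {t : ℝ}
    (hfin : inverseMoment D P p t ≠ ∞) :
    Integrable (fun ω => (inverseProcess D t ω : ℝ) ^ p) P := by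
  rw [inverseMoment_eq_lintegral_ofReal D P hp] at hfin
  exact (lintegral_ofReal_ne_top_iff_integrable
    ((hD.measurable_inverseProcess t).coe_nnreal_real.pow_const p).aestronglyMeasurable
    (Eventually.of_forall fun ω => Real.rpow_nonneg (NNReal.coe_nonneg _) _)).1 hfin

lemma toReal_inverseMoment (hD : IsClock D) {p : ℝ} (hp : 0 ≤ p) (t : ℝ) :
    (inverseMoment D P p t).toReal = ∫ ω, (inverseProcess D t ω : ℝ) ^ p ∂P := by
  rw [inverseMoment_eq_lintegral_ofReal D P hp, integral_eq_lintegral_of_nonneg_ae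
    (Eventually.of_forall fun ω => Real.rpow_nonneg (NNReal.coe_nonneg _) _)
    ((hD.measurable_inverseProcess t).coe_nnreal_real.pow_const p).aestronglyMeasurable]

variable [IsProbabilityMeasure P]

lemma renewal_identity (hD : IsClock D)
    (hind : ∀ u h : ℝ≥0, IndepFun (D u) (fun ω => D (u + h) ω - D u ω) P)
    (hst : ∀ u h : ℝ≥0, IdentDistrib (fun ω => D (u + h) ω - D u ω) (D h) P P)
    {p : ℝ} (hp : 0 < p) (hfin : ∀ t, inverseMoment D P p t ≠ ∞)
    (hfin1 : ∀ t, inverseMoment D P 1 t ≠ ∞) (hU : Monotone (renewalFunction D P))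
    {s t : ℝ} (h : s ≤ t) :
    (∫⁻ y in Set.Icc 0 s, inverseMoment D P (p - 1) (t - y) ∂hU.stieltjesFunction.measure) ≠ ∞ ∧
    ∫ ω, ((inverseProcess D t ω : ℝ) ^ p + (inverseProcess D s ω : ℝ) ^ p -
        |(inverseProcess D t ω : ℝ) - (inverseProcess D s ω : ℝ)| ^ p) ∂P =
      (inverseMoment D P p s).toReal +
        p * (∫⁻ y in Set.Icc 0 s, inverseMoment D P (p - 1) (t - y)
          ∂hU.stieltjesFunction.measure).toReal := by
  have hle (ω : Ω) : inverseProcess D s ω ≤ inverseProcess D t ω := hD.inverseProcess_mono ω h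
  have hIt := hD.integrable_inverseProcess_rpow hp.le (hfin t)
  have hIs := hD.integrable_inverseProcess_rpow hp.le (hfin s)
  have hId : Integrable (fun ω =>
      ((inverseProcess D t ω - inverseProcess D s ω : ℝ≥0) : ℝ) ^ p) P := by
    refine hIt.mono' ?_ (Eventually.of_forall fun ω => ?_)
    · exact ((((hD.measurable_inverseProcess t).sub
        (hD.measurable_inverseProcess s)).coe_nnreal_real).pow_const p).aestronglyMeasurable
    · rw [Real.norm_of_nonneg (by positivity)]
      exact Real.rpow_le_rpow (NNReal.coe_nonneg _) (NNReal.coe_le_coe.2 tsub_le_self) hp.le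
  have hIq : Integrable (fun ω => ((inverseProcess D t ω : ℝ) ^ p -
      ((inverseProcess D t ω - inverseProcess D s ω : ℝ≥0) : ℝ) ^ p) / p) P :=
    (hIt.sub hId).div_const p
  have hnn : 0 ≤ᵐ[P] fun ω => ((inverseProcess D t ω : ℝ) ^ p -
      ((inverseProcess D t ω - inverseProcess D s ω : ℝ≥0) : ℝ) ^ p) / p :=
    Eventually.of_forall fun ω => div_nonneg (sub_nonneg.2 (Real.rpow_le_rpow
      (NNReal.coe_nonneg _) (NNReal.coe_le_coe.2 tsub_le_self) hp.le)) hp.le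
  rw [hD.stieltjesFunction_measure_eq hfin1 hU, hD.setLIntegral_inverseMoment_sub hind hst hp h]
  refine ⟨hIq.lintegral_lt_top.ne, ?_⟩
  rw [← integral_eq_lintegral_of_nonneg_ae hnn hIq.aestronglyMeasurable,
    hD.toReal_inverseMoment hp.le, ← integral_const_mul, ← integral_add hIs (hIq.const_mul p)]
  refine integral_congr_ae (Eventually.of_forall fun ω => ?_)
  have habs : |(inverseProcess D t ω : ℝ) - (inverseProcess D s ω : ℝ)| =
      ((inverseProcess D t ω - inverseProcess D s ω : ℝ≥0) : ℝ) := by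
    rw [NNReal.coe_sub (hle ω), abs_of_nonneg (sub_nonneg.2 (NNReal.coe_le_coe.2 (hle ω)))]
  simp only [habs]
  rw [mul_div_cancel₀ _ hp.ne']
  ring

end IsClock

/-! ### Tails of a subordinator -/

namespace IsSubordinator

variable {Ω : Type*} [MeasurableSpace Ω] {P : Measure Ω} {D : ℝ≥0 → Ω → ℝ}
  {φ : ℝ → ℝ}

lemma ae_exp_le_one (hD : IsSubordinator D P) {l : ℝ} (hl : 0 ≤ l) (s : ℝ≥0) :
    ∀ᵐ ω ∂P, Real.exp (-l * D s ω) ≤ 1 := by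
  filter_upwards [hD.start_zero, hD.monotone_paths] with ω h0 hmono
  have h : 0 ≤ D s ω := h0.symm.le.trans (hmono zero_le)
  rw [Real.exp_le_one_iff, neg_mul]
  exact neg_nonpos.2 (mul_nonneg hl h)

variable [IsProbabilityMeasure P]

lemma integrable_exp (hD : IsSubordinator D P) {l : ℝ} (hl : 0 ≤ l) (s : ℝ≥0) :
    Integrable (fun ω => Real.exp (-l * D s ω)) P := by
  refine (integrable_const (1 : ℝ)).mono'
    ((hD.measurable s).const_mul (-l)).exp.aestronglyMeasurable ?_
  filter_upwards [hD.ae_exp_le_one hl s] with ω hω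
  rwa [Real.norm_of_nonneg (Real.exp_pos _).le]

lemma laplaceExponent_nonneg (hD : IsSubordinator D P) (hφ : HasLaplaceExponent D φ P)
    {l : ℝ} (hl : 0 ≤ l) : 0 ≤ φ l := by
  have h := integral_mono_ae (hD.integrable_exp hl 1) (integrable_const (1 : ℝ))
    (hD.ae_exp_le_one hl 1)
  rw [hφ 1 l hl] at h
  simpa using h

/-- Chernoff bound with exponent `-l`. -/
lemma measure_le_le (hD : IsSubordinator D P) (hφ : HasLaplaceExponent D φ P)
    {l : ℝ} (hl : 0 ≤ l) (u : ℝ≥0) (t : ℝ) :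
    P {ω | D u ω ≤ t} ≤ ENNReal.ofReal (Real.exp (l * t) * Real.exp (-φ l * u)) := by
  have h := measure_le_le_exp_mul_mgf (μ := P) (X := D u) (t := -l) t (neg_nonpos.2 hl)
    (hD.integrable_exp hl u)
  rw [mgf, hφ u l hl, neg_neg] at h
  rw [← ENNReal.ofReal_toReal (measure_ne_top P _)]
  refine ENNReal.ofReal_le_ofReal (h.trans_eq ?_)
  congr 2
  ring

lemma ae_unbounded (hD : IsSubordinator D P) (hφ : HasLaplaceExponent D φ P)
    {l : ℝ} (hl : 0 ≤ l) (hφl : 0 < φ l) : ∀ᵐ ω ∂P, ∀ t : ℝ, ∃ s, t < D s ω := by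
  have h (n : ℕ) : ∀ᵐ ω ∂P, ∃ s, (n : ℝ) < D s ω := by
    have hlim : Tendsto (fun k : ℕ => ENNReal.ofReal
        (Real.exp (l * n) * Real.exp (-φ l * ((k : ℝ≥0) : ℝ)))) atTop (𝓝 0) := by
      rw [← ENNReal.ofReal_zero]
      refine ENNReal.tendsto_ofReal ?_
      rw [← mul_zero (Real.exp (l * n))]
      refine Tendsto.const_mul _ (Real.tendsto_exp_atBot.comp ?_)
      simp only [NNReal.coe_natCast]
      exact tendsto_natCast_atTop_atTop.const_mul_atTop_of_neg (neg_neg_of_pos hφl)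
    refine ae_iff.2 (le_antisymm (ge_of_tendsto' hlim fun k => ?_) zero_le)
    refine le_trans (measure_mono fun ω hω => ?_) (hD.measure_le_le hφ hl k n)
    have hω' : ¬ ∃ s, (n : ℝ) < D s ω := hω
    push Not at hω'
    exact hω' k
  filter_upwards [ae_all_iff.2 h] with ω hω t
  obtain ⟨n, hn⟩ := exists_nat_gt t
  obtain ⟨s, hs⟩ := hω n
  exact ⟨s, hn.trans hs⟩

/-- A nondegenerate subordinator is indistinguishable from a process with everywhere regular
paths. -/
lemma exists_isClock (hD : IsSubordinator D P) (hφ : HasLaplaceExponent D φ P)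
    {l : ℝ} (hl : 0 ≤ l) (hφl : 0 < φ l) :
    ∃ D' : ℝ≥0 → Ω → ℝ, IsClock D' ∧ ∀ᵐ ω ∂P, ∀ s, D s ω = D' s ω := by
  classical
  obtain ⟨A, hA, hAm, hAP⟩ := (hD.start_zero.and (hD.monotone_paths.and
    (hD.rightContinuous_paths.and (hD.ae_unbounded hφ hl hφl)))).exists_measurable_mem
  refine ⟨fun s ω => if ω ∈ A then D s ω else s, ⟨fun s => ?_, fun ω => ?_, fun ω => ?_,
    -- Off the good set the path is replaced by `s ↦ s`, which is itself a clock; the zero path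
    -- would not be unbounded.
    fun ω => ?_, fun ω => ?_⟩, ?_⟩
  · exact Measurable.ite hAm (hD.measurable s) measurable_const
  · by_cases h : ω ∈ A
    · simp [h, (hAP ω h).1]
    · simp [h]
  · by_cases h : ω ∈ A
    · simpa [h] using (hAP ω h).2.1
    · simpa [h] using NNReal.coe_mono
  · by_cases h : ω ∈ A
    · simpa [h] using (hAP ω h).2.2.1
    · simpa [h] using fun s => NNReal.continuous_coe.continuousWithinAt
  · by_cases h : ω ∈ A
    · simpa [h] using (hAP ω h).2.2.2
    · intro t
      simp only [h, if_false]
      exact ⟨t.toNNReal + 1, by push_cast; linarith [Real.le_coe_toNNReal t]⟩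
  · filter_upwards [hA] with ω hω s
    simp [hω]

end IsSubordinator

/-! ### Passage to regular versions and conclusion -/

lemma exists_continuous_version {Ω : Type*} [MeasurableSpace Ω] {P : Measure Ω}
    {B : ℝ≥0 → Ω → ℝ} (hm : ∀ t, Measurable (B t)) (hc : ∀ᵐ ω ∂P, Continuous fun t => B t ω) :
    ∃ B' : ℝ≥0 → Ω → ℝ, (∀ t, Measurable (B' t)) ∧ (∀ ω, Continuous fun t => B' t ω) ∧
      ∀ᵐ ω ∂P, ∀ t, B t ω = B' t ω := by
  classical
  obtain ⟨A, hA, hAm, hAP⟩ := hc.exists_measurable_mem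
  refine ⟨fun t ω => if ω ∈ A then B t ω else 0, fun t => ?_, fun ω => ?_, ?_⟩
  · exact Measurable.ite hAm (hm t) measurable_const
  · by_cases h : ω ∈ A
    · simpa [h] using hAP ω h
    · simpa [h] using continuous_const
  · filter_upwards [hA] with ω hω t
    simp [hω]

lemma covariance_congr_ae {Ω : Type*} [MeasurableSpace Ω] {P : Measure Ω} {X X' Y Y' : Ω → ℝ}
    (hX : X =ᵐ[P] X') (hY : Y =ᵐ[P] Y') : cov[X, Y; P] = cov[X', Y'; P] := by
  simp only [covariance, integral_congr_ae hX, integral_congr_ae hY]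
  refine integral_congr_ae ?_
  filter_upwards [hX, hY] with ω h1 h2
  rw [h1, h2]

theorem theorem3p1 {Ω : Type*} [MeasurableSpace Ω] (P : Measure Ω) [IsProbabilityMeasure P]
    (H : ℝ) (hH0 : 0 < H) (hH1 : H < 1)
    (B D : ℝ≥0 → Ω → ℝ) (φ : ℝ → ℝ)
    (hB : IsFractionalBrownianMotion B H P)
    (hD : IsSubordinator D P)
    (hφ : HasLaplaceExponent D φ P)
    -- the subordinator is not identically zero
    (hφ0 : ∃ l : ℝ, 0 < l ∧ φ l ≠ 0)
    -- the processes `B` and `Y` are independent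
    (hBY : IndepFun (fun ω (t : ℝ≥0) => B t ω) (fun ω (t : ℝ≥0) => inverseProcess D t ω) P) :
    (∀ t : ℝ, 0 ≤ t → MemLp (timeChanged B D t) 2 P) ∧
    (∀ t : ℝ, 0 ≤ t → inverseMoment D P 1 t ≠ ∞ ∧ inverseMoment D P (2 * H) t ≠ ∞) ∧
    ∃ hU : Monotone (renewalFunction D P), ∀ t s : ℝ, 0 ≤ t → 0 ≤ s →
      (∫⁻ y in Set.Icc 0 (min t s), inverseMoment D P (2 * H - 1) (max t s - y)
        ∂hU.stieltjesFunction.measure) ≠ ∞ ∧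
      cov[timeChanged B D t, timeChanged B D s; P] =
        Var[B 1; P] / 2 *
          ((inverseMoment D P (2 * H) (min t s)).toReal +
            2 * H * (∫⁻ y in Set.Icc 0 (min t s), inverseMoment D P (2 * H - 1) (max t s - y)
              ∂hU.stieltjesFunction.measure).toReal) := by
  obtain ⟨l, hl, hφl⟩ := hφ0
  have hφpos : 0 < φ l := lt_of_le_of_ne (hD.laplaceExponent_nonneg hφ hl.le) hφl.symm
  have hp : 0 < 2 * H := by linarith
  obtain ⟨D', hC, hDD'⟩ := hD.exists_isClock hφ hl.le hφpos
  obtain ⟨B', hBm, hBc, hBB'⟩ := exists_continuous_version hB.measurable hB.continuous_paths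
  have hY : ∀ᵐ ω ∂P, ∀ t, inverseProcess D t ω = inverseProcess D' t ω := by
    filter_upwards [hDD'] with ω hω t
    simp only [inverseProcess, hω]
  have hM : inverseMoment D P = inverseMoment D' P := by
    ext γ t
    exact lintegral_congr_ae (hY.mono fun ω hω => by simp only [hω])
  have hR : renewalFunction D P = renewalFunction D' P := by
    ext t
    simp only [renewalFunction, hM]
  have hZ (t : ℝ) : timeChanged B D t =ᵐ[P] fun ω => B' (inverseProcess D' t ω) ω := by
    filter_upwards [hY, hBB'] with ω h1 h2
    rw [timeChanged, h1, h2]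
  have hDae (s : ℝ≥0) : D s =ᵐ[P] D' s := hDD'.mono fun ω hω => hω s
  have hinc (u h : ℝ≥0) : (fun ω => D (u + h) ω - D u ω) =ᵐ[P]
      fun ω => D' (u + h) ω - D' u ω := (hDae _).sub (hDae _)
  have hind (u h : ℝ≥0) : IndepFun (D' u) (fun ω => D' (u + h) ω - D' u ω) P :=
    (hD.indep_increments.indepFun_eval_sub (zero_le : (0 : ℝ≥0) ≤ u) le_self_add
      hD.start_zero).congr (hDae u) (hinc u h)
  have hst (u h : ℝ≥0) : IdentDistrib (fun ω => D' (u + h) ω - D' u ω) (D' h) P P :=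
    ((IdentDistrib.of_ae_eq ((hC.measurable _).sub (hC.measurable _)).aemeasurable
      (hinc u h).symm).trans (hD.stationary_increments u h)).trans
      (IdentDistrib.of_ae_eq (hD.measurable h).aemeasurable (hDae h))
  have hfin {p : ℝ} (hp : 0 < p) (t : ℝ) : inverseMoment D' P p t ≠ ∞ := by
    refine hC.inverseMoment_ne_top (C := Real.exp (l * t)) hp hφpos fun u => ?_
    refine le_of_eq_of_le (measure_congr ?_) (hD.measure_le_le hφ hl.le u t)
    filter_upwards [hDae u] with ω hω
    exact congrArg (· ≤ t) hω.symm
  have hBae (t : ℝ≥0) : B t =ᵐ[P] B' t := hBB'.mono fun ω hω => hω t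
  have hL2 (t : ℝ≥0) : MemLp (B' t) 2 P :=
    (hB.isGaussianProcess.hasGaussianLaw_eval t).memLp_two.ae_eq (hBae t)
  have hB0 (t : ℝ≥0) : ∫ ω, B' t ω ∂P = 0 := by
    rw [← integral_congr_ae (hBae t), hB.mean_zero]
  have hcov (t s : ℝ≥0) : ∫ ω, B' t ω * B' s ω ∂P = Var[B 1; P] / 2 *
      ((t : ℝ) ^ (2 * H) + (s : ℝ) ^ (2 * H) - |(t : ℝ) - (s : ℝ)| ^ (2 * H)) :=
    (integral_congr_ae ((hBae t).mul (hBae s)).symm).trans (hB.covariance_formula t s)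
  have hI (t s : ℝ) (ht : 0 ≤ t) (hs : 0 ≤ s) : IndepFun (fun ω t => B' t ω)
      (fun ω => (inverseProcess D' t ω, inverseProcess D' s ω)) P := by
    refine (hBY.comp measurable_id ((measurable_pi_apply t.toNNReal).prodMk
      (measurable_pi_apply s.toNNReal))).congr ?_ ?_
    · filter_upwards [hBB'] with ω hω
      ext t
      exact hω t
    · filter_upwards [hY] with ω hω
      simp [hω, ht, hs]
  have hYm := hC.measurable_inverseProcess
  have hYp (t : ℝ) := hC.integrable_inverseProcess_rpow hp.le (hfin hp t)
  rw [hR, hM]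
  refine ⟨fun t ht => (memLp_congr_ae (hZ t)).2
      (memLp_timeChange hp hBm hBc hL2 hcov (hYm t) (hYp t) (hI t t ht ht)),
    fun t _ => ⟨hfin one_pos t, hfin hp t⟩,
    hC.monotone_renewalFunction (hfin one_pos), ?_⟩
  intro t s ht hs
  -- Both sides are symmetric in `t` and `s`.
  wlog hle : s ≤ t generalizing t s with hsymm
  · rw [min_comm, max_comm, covariance_comm]
    exact hsymm s t hs ht (le_of_not_ge hle)
  rw [min_eq_right hle, max_eq_left hle]
  obtain ⟨h1, h2⟩ := hC.renewal_identity hind hst hp (hfin hp) (hfin one_pos)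
    (hC.monotone_renewalFunction (hfin one_pos)) hle
  refine ⟨h1, ?_⟩
  rw [← h2, ← integral_const_mul, ← covariance_timeChange hp hBm hBc hL2 hB0 hcov (hYm t) (hYp t)
    (hYm s) (hYp s) (hI t s ht hs)]
  exact covariance_congr_ae (hZ t) (hZ s)
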